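/- Let $f:[0,1]\to[0,1]$ be continuous. For $A\subseteq[0,1]$ put $\mathrm{Orb}(A)=\bigcup_{n\ge 0}f^n(A)$. If $K\subseteq[0,1]$ is a non-degenerate closed interval and $k\ge 1$ is such that $K,f(K),\dots,f^{k-1}(K)$ are pairwise disjoint and $f^k(K)=K$, then $\mathrm{Orb}(K)$ is called a cycle of intervals of period $k$. For $y\in[0,1]$, let $\omega(y)$ be the set of all limits of convergent subsequences of $(f^n(y))_{n\ge0}$; let $\alpha(y)$ be the set of all limits of convergent subsequences of sequences $(x_n)_{n\ge 0}$ with $f^n(x_n)=y$ for all $n\ge 0$; and let $s\alpha(y)$ be the set of all limits of convergent subsequences of sequences $(x_n)_{n\ge 0}$ with $x_0=y$ and $f(x_{n+1})=x_n$ for all $n\ge 0$. Let $\mathrm{Rec}(f)=\{x\in[0,1]: x\in\omega(x)\}$. Let $\mathrm{Orb}(I_0)\supseteq\mathrm{Orb}(I_1)\supseteq\cdots$ be a nested sequence of cycles of intervals for $f$ with periods tending to infinity. Let $Q=\bigcap_{n\ge 0}\mathrm{Orb}(I_n)$ and $S=Q\cap\mathrm{Rec}(f)$. Then, for every $y\in[0,1]$: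 1. If $\alpha(y)\cap Q\neq\emptyset$, then $y\in Q$. 2. If $y\in Q$, then $s\alpha(y)\supseteq S$ and $s\alpha(y)\cap Q=S$. -/

import Mathlib

namespace IntervalMap

/-- The forward orbit `⋃ n ≥ 0, f^n(A)` of a set `A`. -/
def orb {X : Type*} (f : X → X) (A : Set X) : Set X :=
  ⋃ n : ℕ, f^[n] '' A

/-- A preimage sequence of `y`: `f^n (x n) = y` for all `n`. -/
def IsPreimageSequence {X : Type*} (f : X → X) (y : X) (x : ℕ → X) : Prop :=
  ∀ n, f^[n] (x n) = y

/-- A backward orbit branch of `y`: `x 0 = y` and `f (x (n + 1)) = x n` for all `n`. -/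
def IsBackwardOrbitBranch {X : Type*} (f : X → X) (y : X) (x : ℕ → X) : Prop :=
  x 0 = y ∧ ∀ n, f (x (n + 1)) = x n

/-- `z` is the limit of some subsequence of the sequence `x`. -/
def IsSubseqLimit {X : Type*} [TopologicalSpace X] (x : ℕ → X) (z : X) : Prop :=
  ∃ φ : ℕ → ℕ, StrictMono φ ∧ Filter.Tendsto (fun i => x (φ i)) Filter.atTop (nhds z)

/-- The ω-limit set of `x`: subsequential limits of its forward orbit. -/
def omegaLimitSet {X : Type*} [TopologicalSpace X] (f : X → X) (x : X) : Set X :=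
  {z | IsSubseqLimit (fun n => f^[n] x) z}

/-- The α-limit set of `y`: subsequential limits of its preimage sequences. -/
def alphaLimitSet {X : Type*} [TopologicalSpace X] (f : X → X) (y : X) : Set X :=
  {z | ∃ x : ℕ → X, IsPreimageSequence f y x ∧ IsSubseqLimit x z}

/-- The special α-limit set of `y`: subsequential limits of its backward orbit branches. -/
def specialAlphaLimitSet {X : Type*} [TopologicalSpace X] (f : X → X) (y : X) : Set X :=
  {z | ∃ x : ℕ → X, IsBackwardOrbitBranch f y x ∧ IsSubseqLimit x z}

/-- `Rec(f)`: the points `x` with `x ∈ ω(x)`. -/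
def recurrentPoints {X : Type*} [TopologicalSpace X] (f : X → X) : Set X :=
  {x | x ∈ omegaLimitSet f x}

/-- `K` is a non-degenerate closed interval in `[0,1]` with `K, f(K), …, f^(k-1)(K)` pairwise
disjoint and `f^k(K) = K`, so that `orb f K` is a cycle of intervals of period `k ≥ 1`. -/
def IsPeriodicInterval (f : unitInterval → unitInterval) (K : Set unitInterval) (k : ℕ) : Prop :=
  (∃ a b : unitInterval, a < b ∧ K = Set.Icc a b) ∧ 1 ≤ k ∧
    (Set.Iio k).PairwiseDisjoint (fun i => f^[i] '' K) ∧ f^[k] '' K = K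

/-- The sets `orb f (I 0) ⊇ orb f (I 1) ⊇ ⋯` form a nested sequence of cycles of intervals
whose periods tend to infinity. -/
def IsGeneratingSequence (f : unitInterval → unitInterval) (I : ℕ → Set unitInterval) : Prop :=
  (∀ n, orb f (I (n + 1)) ⊆ orb f (I n)) ∧
    ∃ m : ℕ → ℕ, (∀ n, IsPeriodicInterval f (I n) (m n)) ∧
      Filter.Tendsto m Filter.atTop Filter.atTop

end IntervalMap

/-! A return to the same component of `orb f (I n)` takes a multiple of the period, and the periods
tend to infinity. So two points of `Q` on one orbit eventually lie in different components
(`eventually_separated`), and orbits in `Q` never repeat.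

Part 1: an infinite orbit in `Q` avoids the finitely many component endpoints at some time, so
preimages close to `z` are carried into the invariant cycle, and `y` with them.

Part 2: a convex set visited three times by such a sequence in `Q` contains a whole component
(`exists_subset`), and every forward orbit or backward branch in `Q` visits each component
infinitely often. Recurrence of a point and accumulation of a branch at it therefore imply each
other. -/

namespace IntervalMap

/-! ### Iterates, backward branches and orbit relation -/

section General

variable {X : Type*} {f : X → X} {K : Set X} {k i j : ℕ}

theorem image_iterate_add_period (h : f^[k] '' K = K) (i : ℕ) :
    f^[i + k] '' K = f^[i] '' K := by
  rw [Function.iterate_add, Set.image_comp, h]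

theorem image_iterate_mod_period (h : f^[k] '' K = K) (i : ℕ) :
    f^[i % k] '' K = f^[i] '' K := by
  have key : ∀ q r : ℕ, f^[r + k * q] '' K = f^[r] '' K := by
    intro q r
    induction q with
    | zero => simp
    | succ q ih => rw [Nat.mul_succ, ← Nat.add_assoc, image_iterate_add_period h, ih]
  conv_rhs => rw [← Nat.mod_add_div i k]
  rw [key]

theorem image_iterate_congr (h : f^[k] '' K = K) (hij : i ≡ j [MOD k]) :
    f^[i] '' K = f^[j] '' K := by
  rw [← image_iterate_mod_period h i, hij, image_iterate_mod_period h j]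

theorem iterate_mem_image_iterate {x : X} (hx : x ∈ f^[i] '' K) (d : ℕ) :
    f^[d] x ∈ f^[i + d] '' K := by
  obtain ⟨u, hu, rfl⟩ := hx
  exact ⟨u, hu, by rw [Nat.add_comm, Function.iterate_add_apply]⟩

theorem mem_orb {x : X} : x ∈ orb f K ↔ ∃ i, x ∈ f^[i] '' K := by
  simp only [orb, Set.mem_iUnion]

theorem iterate_mem_orb {x : X} (hx : x ∈ orb f K) (d : ℕ) : f^[d] x ∈ orb f K := by
  obtain ⟨i, hi⟩ := mem_orb.1 hx
  exact mem_orb.2 ⟨i + d, iterate_mem_image_iterate hi d⟩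

theorem orb_eq_biUnion (hk : 1 ≤ k) (h : f^[k] '' K = K) :
    orb f K = ⋃ i ∈ Finset.range k, f^[i] '' K := by
  ext x
  simp only [mem_orb, Set.mem_iUnion, Finset.mem_range, exists_prop]
  constructor
  · rintro ⟨i, hi⟩
    exact ⟨i % k, Nat.mod_lt _ hk, by rwa [image_iterate_mod_period h]⟩
  · rintro ⟨i, -, hi⟩
    exact ⟨i, hi⟩

theorem exists_preimage_mem_orb (hk : 1 ≤ k) (h : f^[k] '' K = K) {y : X} (hy : y ∈ orb f K) :
    ∃ x ∈ orb f K, f x = y := by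
  obtain ⟨i, hi⟩ := mem_orb.1 hy
  rw [← image_iterate_add_period h] at hi
  obtain ⟨u, hu, rfl⟩ := hi
  refine ⟨f^[i + (k - 1)] u, mem_orb.2 ⟨_, u, hu, rfl⟩, ?_⟩
  rw [← Function.iterate_succ_apply' f]
  congr 2
  omega

theorem IsBackwardOrbitBranch.iterate {y : X} {x : ℕ → X} (hx : IsBackwardOrbitBranch f y x)
    (N t : ℕ) : f^[t] (x (N + t)) = x N := by
  induction t with
  | zero => rfl
  | succ t ih => rw [Function.iterate_succ_apply, ← Nat.add_assoc, hx.2, ih]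

theorem exists_isBackwardOrbitBranch {Q : Set X} (h : ∀ y ∈ Q, ∃ x ∈ Q, f x = y) {y : X}
    (hy : y ∈ Q) : ∃ x : ℕ → X, IsBackwardOrbitBranch f y x ∧ ∀ n, x n ∈ Q := by
  choose! g hgQ hg using h
  have hmem : ∀ n, g^[n] y ∈ Q := by
    intro n
    induction n with
    | zero => exact hy
    | succ n ih => rw [Function.iterate_succ_apply']; exact hgQ _ ih
  exact ⟨fun n => g^[n] y, ⟨rfl, fun n => by
    simp only [Function.iterate_succ_apply', hg _ (hmem n)]⟩, hmem⟩

theorem isSubseqLimit_iff_frequently [TopologicalSpace X] [FirstCountableTopology X]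
    {x : ℕ → X} {z : X} :
    IsSubseqLimit x z ↔ ∀ U ∈ nhds z, ∃ᶠ n in Filter.atTop, x n ∈ U := by
  rw [← mapClusterPt_iff_frequently]
  constructor
  · rintro ⟨φ, hφ, h⟩
    exact MapClusterPt.of_comp hφ.tendsto_atTop h.mapClusterPt
  · exact MapClusterPt.tendsto_subseq

/-- One of the two points is a proper forward iterate of the other. -/
def OrbitRelated (f : X → X) (p q : X) : Prop :=
  ∃ d, 1 ≤ d ∧ (f^[d] p = q ∨ f^[d] q = p)

theorem OrbitRelated.symm {p q : X} (h : OrbitRelated f p q) : OrbitRelated f q p := by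
  obtain ⟨d, hd, h⟩ := h
  exact ⟨d, hd, h.symm⟩

theorem orbitRelated_iterate (z : X) (h : i < j) : OrbitRelated f (f^[i] z) (f^[j] z) :=
  ⟨j - i, by omega, Or.inl (by rw [← Function.iterate_add_apply, Nat.sub_add_cancel h.le])⟩

theorem IsBackwardOrbitBranch.orbitRelated {y : X} {x : ℕ → X}
    (hx : IsBackwardOrbitBranch f y x) (h : i < j) : OrbitRelated f (x i) (x j) :=
  ⟨j - i, by omega, Or.inr (by
    have := hx.iterate i (j - i)
    rwa [Nat.add_sub_cancel' h.le] at this)⟩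

end General

/-! ### A single cycle of intervals -/

section PeriodicInterval

variable {f : unitInterval → unitInterval} {K : Set unitInterval} {k : ℕ}

theorem IsPeriodicInterval.modEq (hK : IsPeriodicInterval f K k) {i j : ℕ} {x : unitInterval}
    (hi : x ∈ f^[i] '' K) (hj : x ∈ f^[j] '' K) : i ≡ j [MOD k] := by
  obtain ⟨-, hk, hd, h⟩ := hK
  by_contra hne
  rw [← image_iterate_mod_period h] at hi hj
  exact Set.disjoint_left.1 (hd (Nat.mod_lt i hk) (Nat.mod_lt j hk) hne) hi hj

theorem IsPeriodicInterval.exists_eq_Icc (hf : Continuous f) (hK : IsPeriodicInterval f K k)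
    (i : ℕ) : ∃ a b, f^[i] '' K = Set.Icc a b := by
  obtain ⟨⟨a, b, hab, rfl⟩, -⟩ := hK
  have hc : Continuous f^[i] := hf.iterate i
  exact ⟨_, _, eq_Icc_of_connected_compact
    ((isConnected_Icc hab.le).image _ hc.continuousOn) (isCompact_Icc.image hc)⟩

theorem IsPeriodicInterval.isCompact_orb (hf : Continuous f) (hK : IsPeriodicInterval f K k) :
    IsCompact (orb f K) := by
  rw [orb_eq_biUnion hK.2.1 hK.2.2.2]
  refine (Finset.range k).isCompact_biUnion fun i _ => ?_
  obtain ⟨a, b, h⟩ := hK.exists_eq_Icc hf i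
  rw [h]
  exact isCompact_Icc

/-- An infinite set of points of a cycle of intervals meets the interior of the cycle. -/
theorem IsPeriodicInterval.exists_mem_interior (hf : Continuous f)
    (hK : IsPeriodicInterval f K k) {x : ℕ → unitInterval} (hx : Function.Injective x)
    (hmem : ∀ n, x n ∈ orb f K) : ∃ n, x n ∈ interior (orb f K) := by
  choose a b hab using hK.exists_eq_Icc hf
  -- The endpoints of all components: finite, so an injective sequence leaves it.
  set E : Finset unitInterval := (Finset.range k).image a ∪ (Finset.range k).image b
  obtain ⟨n, hn⟩ : ∃ n, x n ∉ E := by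
    by_contra! hall
    exact Set.infinite_range_of_injective hx
      (E.finite_toSet.subset (Set.range_subset_iff.2 hall))
  refine ⟨n, ?_⟩
  have hxn := hmem n
  rw [orb_eq_biUnion hK.2.1 hK.2.2.2] at hxn
  simp only [Set.mem_iUnion, Finset.mem_range, exists_prop] at hxn
  obtain ⟨i, hi, hxi⟩ := hxn
  have hsub : Set.Ioo (a i) (b i) ⊆ orb f K := fun u hu =>
    mem_orb.2 ⟨i, by rw [hab]; exact Set.Ioo_subset_Icc_self hu⟩
  refine interior_maximal hsub isOpen_Ioo ?_
  rw [hab] at hxi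
  have ha : a i ∈ E := Finset.mem_union_left _ (Finset.mem_image_of_mem _ (Finset.mem_range.2 hi))
  have hb : b i ∈ E := Finset.mem_union_right _ (Finset.mem_image_of_mem _ (Finset.mem_range.2 hi))
  exact ⟨lt_of_le_of_ne hxi.1 fun h => hn (h ▸ ha), lt_of_le_of_ne hxi.2 fun h => hn (h ▸ hb)⟩

theorem IsPeriodicInterval.frequently_iterate_mem (hK : IsPeriodicInterval f K k)
    {z : unitInterval} (hz : z ∈ orb f K) (i : ℕ) :
    ∃ᶠ n in Filter.atTop, f^[n] z ∈ f^[i] '' K := by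
  obtain ⟨l, hl⟩ := mem_orb.1 hz
  -- Starting in class `l`, this time leads to `i + k * (l + N)`, which is `i` modulo `k`.
  refine Filter.frequently_atTop.2 fun N => ⟨i + (k - 1) * l + k * N, ?_, ?_⟩
  · nlinarith [hK.2.1, Nat.zero_le ((k - 1) * l)]
  · have h := iterate_mem_image_iterate hl (i + (k - 1) * l + k * N)
    rwa [image_iterate_congr hK.2.2.2 (j := i)] at h
    obtain ⟨c, rfl⟩ := Nat.exists_eq_add_of_le hK.2.1
    rw [show l + (i + (1 + c - 1) * l + (1 + c) * N) = i + (1 + c) * (l + N) by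
      rw [Nat.add_sub_cancel_left]; ring]
    exact Nat.ModEq.symm (by simp [Nat.ModEq])

theorem IsPeriodicInterval.frequently_branch_mem (hK : IsPeriodicInterval f K k)
    {y : unitInterval} {x : ℕ → unitInterval} (hx : IsBackwardOrbitBranch f y x)
    (hmem : ∀ n, x n ∈ orb f K) (i : ℕ) : ∃ᶠ n in Filter.atTop, x n ∈ f^[i] '' K := by
  refine Filter.frequently_atTop.2 fun N => ?_
  obtain ⟨c, hc⟩ := mem_orb.1 (hmem N)
  obtain ⟨l, hl⟩ := mem_orb.1 (hmem (N + (c + (k - 1) * i)))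
  -- From class `i`, `c + (k - 1) * i` steps lead to class `c`; cancelling them forces `l ≡ i`.
  refine ⟨N + (c + (k - 1) * i), Nat.le_add_right _ _, ?_⟩
  have h := iterate_mem_image_iterate hl (c + (k - 1) * i)
  rw [hx.iterate] at h
  have h1 := hK.modEq h hc
  have h2 : i + (c + (k - 1) * i) ≡ c [MOD k] := by
    obtain ⟨e, rfl⟩ := Nat.exists_eq_add_of_le hK.2.1
    rw [show i + (c + (1 + e - 1) * i) = c + (1 + e) * i by
      rw [Nat.add_sub_cancel_left]; ring]
    simp [Nat.ModEq]
  rwa [← image_iterate_congr hK.2.2.2 (Nat.ModEq.add_right_cancel' _ (h1.trans h2.symm))]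

end PeriodicInterval

/-! ### Nested cycles and the solenoidal set -/

section GeneratingSequence

variable {f : unitInterval → unitInterval} {I : ℕ → Set unitInterval}

theorem IsGeneratingSequence.eventually_separated (hI : IsGeneratingSequence f I)
    {p q : unitInterval} (h : OrbitRelated f p q) :
    ∀ᶠ n in Filter.atTop, ∀ i, p ∈ f^[i] '' I n → q ∉ f^[i] '' I n := by
  obtain ⟨-, m, hm, hlim⟩ := hI
  obtain ⟨d, hd, h⟩ := h
  filter_upwards [hlim.eventually_gt_atTop d] with n hn i hp hq
  have key : i + d ≡ i [MOD m n] := by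
    rcases h with rfl | rfl
    · exact (hm n).modEq (iterate_mem_image_iterate hp d) hq
    · exact (hm n).modEq (iterate_mem_image_iterate hq d) hp
  have h0 : d ≡ 0 [MOD m n] := Nat.ModEq.add_left_cancel' i key
  exact absurd (Nat.le_of_dvd hd ((Nat.modEq_zero_iff_dvd).1 h0)) (by omega)

theorem IsGeneratingSequence.injective (hI : IsGeneratingSequence f I)
    {x : ℕ → unitInterval} (hx : ∀ n, x n ∈ ⋂ n, orb f (I n))
    (hrel : ∀ i j, i < j → OrbitRelated f (x i) (x j)) : Function.Injective x := by
  have hne : ∀ i j, i < j → x i ≠ x j := by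
    intro i j hij heq
    obtain ⟨n, hn⟩ := (hI.eventually_separated (hrel i j hij)).exists
    obtain ⟨l, hl⟩ := mem_orb.1 (Set.mem_iInter.1 (hx i) n)
    exact hn l hl (heq ▸ hl)
  intro i j heq
  by_contra hij
  rcases Nat.lt_or_gt_of_ne hij with h | h
  · exact hne i j h heq
  · exact hne j i h heq.symm

/-- For large `n` the component of the middle point `q` is an interval missing `p` and `r`, hence
squeezed between them. -/
theorem IsGeneratingSequence.exists_subset_of_le (hf : Continuous f)
    (hI : IsGeneratingSequence f I) {U : Set unitInterval} (hU : U.OrdConnected)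
    {p q r : unitInterval} (hp : p ∈ U) (hr : r ∈ U)
    (hqQ : q ∈ ⋂ n, orb f (I n)) (hpq : p ≤ q) (hqr : q ≤ r)
    (h₁ : OrbitRelated f q p) (h₂ : OrbitRelated f q r) : ∃ n i, f^[i] '' I n ⊆ U := by
  obtain ⟨n, hn₁, hn₂⟩ :=
    ((hI.eventually_separated h₁).and (hI.eventually_separated h₂)).exists
  obtain ⟨i, hi⟩ := mem_orb.1 (Set.mem_iInter.1 hqQ n)
  obtain ⟨-, m, hm, -⟩ := hI
  obtain ⟨a, b, hab⟩ := (hm n).exists_eq_Icc hf i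
  have hpn := hn₁ i hi
  have hrn := hn₂ i hi
  refine ⟨n, i, fun u hu => hU.out hp hr ?_⟩
  rw [hab] at hi hu hpn hrn
  constructor
  · by_contra! hlt
    exact hpn ⟨hu.1.trans hlt.le, hpq.trans hi.2⟩
  · by_contra! hlt
    exact hrn ⟨hi.1.trans hqr, hlt.le.trans hu.2⟩

/-- A convex set visited frequently by a sequence of points of the solenoidal set, any two of
which lie on a common orbit, contains a component of one of the cycles. -/
theorem IsGeneratingSequence.exists_subset (hf : Continuous f) (hI : IsGeneratingSequence f I)
    {U : Set unitInterval} (hU : U.OrdConnected) {x : ℕ → unitInterval}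
    (hx : ∀ n, x n ∈ ⋂ n, orb f (I n))
    (hrel : ∀ i j, i < j → OrbitRelated f (x i) (x j))
    (hfreq : ∃ᶠ n in Filter.atTop, x n ∈ U) : ∃ n i, f^[i] '' I n ⊆ U := by
  rw [Filter.frequently_atTop] at hfreq
  obtain ⟨i, -, hi⟩ := hfreq 0
  obtain ⟨j, hij, hj⟩ := hfreq (i + 1)
  obtain ⟨l, hjl, hl⟩ := hfreq (j + 1)
  have rij := hrel i j (by omega)
  have ril := hrel i l (by omega)
  have rjl := hrel j l (by omega)
  have key := @exists_subset_of_le f I hf hI U hU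
  -- Sort the three visits; the middle one plays the role of `q`.
  rcases le_total (x i) (x j) with h₁ | h₁ <;> rcases le_total (x j) (x l) with h₂ | h₂ <;>
    rcases le_total (x i) (x l) with h₃ | h₃
  · exact key hi hl (hx j) h₁ h₂ rij.symm rjl
  · exact key hi hl (hx j) h₁ h₂ rij.symm rjl
  · exact key hi hj (hx l) h₃ h₂ ril.symm rjl.symm
  · exact key hl hj (hx i) h₃ h₁ ril rij
  · exact key hj hl (hx i) h₁ h₃ rij ril
  · exact key hj hi (hx l) h₂ h₃ rjl.symm ril.symm
  · exact key hl hi (hx j) h₂ h₁ rjl rij.symm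
  · exact key hl hi (hx j) h₂ h₁ rjl rij.symm

/-- By compactness: the preimages of `y` in the successive cycles form nested nonempty compact sets.
-/
theorem IsGeneratingSequence.exists_preimage_mem (hf : Continuous f)
    (hI : IsGeneratingSequence f I) {y : unitInterval} (hy : y ∈ ⋂ n, orb f (I n)) :
    ∃ x ∈ ⋂ n, orb f (I n), f x = y := by
  obtain ⟨hnest, m, hm, -⟩ := hI
  have hcl : IsClosed (f ⁻¹' {y}) := isClosed_singleton.preimage hf
  obtain ⟨x, hx⟩ := IsCompact.nonempty_iInter_of_sequence_nonempty_isCompact_isClosed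
    (fun n => orb f (I n) ∩ f ⁻¹' {y})
    (fun n => Set.inter_subset_inter_left _ (hnest n))
    (fun n => by
      obtain ⟨x, hx, hxy⟩ :=
        exists_preimage_mem_orb (hm n).2.1 (hm n).2.2.2 (Set.mem_iInter.1 hy n)
      exact ⟨x, hx, hxy⟩)
    (((hm 0).isCompact_orb hf).inter_right hcl)
    (fun n => ((hm n).isCompact_orb hf).isClosed.inter hcl)
  rw [Set.mem_iInter] at hx
  exact ⟨x, Set.mem_iInter.2 fun n => (hx n).1, (hx 0).2⟩

theorem iterate_mem_iInter_orb {z : unitInterval} (hz : z ∈ ⋂ n, orb f (I n)) (d : ℕ) :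
    f^[d] z ∈ ⋂ n, orb f (I n) :=
  Set.mem_iInter.2 fun n => iterate_mem_orb (Set.mem_iInter.1 hz n) d

theorem IsGeneratingSequence.mem_of_mem_alphaLimitSet (hf : Continuous f)
    (hI : IsGeneratingSequence f I) {y z : unitInterval} (hz : z ∈ alphaLimitSet f y)
    (hzQ : z ∈ ⋂ n, orb f (I n)) : y ∈ ⋂ n, orb f (I n) := by
  refine Set.mem_iInter.2 fun n => ?_
  have hinj : Function.Injective fun j => f^[j] z :=
    hI.injective (iterate_mem_iInter_orb hzQ) fun i j h => orbitRelated_iterate z h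
  obtain ⟨-, m, hm, -⟩ := hI
  obtain ⟨j, hj⟩ := (hm n).exists_mem_interior hf hinj
    fun j => iterate_mem_orb (Set.mem_iInter.1 hzQ n) j
  obtain ⟨x, hx, hxz⟩ := hz
  have hU : f^[j] ⁻¹' orb f (I n) ∈ nhds z :=
    (hf.iterate j).continuousAt (mem_interior_iff_mem_nhds.1 hj)
  obtain ⟨l, hl, hlx⟩ :=
    Filter.frequently_atTop.1 (isSubseqLimit_iff_frequently.1 hxz _ hU) j
  have h := iterate_mem_orb hlx (l - j)
  rwa [← Function.iterate_add_apply, Nat.sub_add_cancel hl, hx l] at h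

/-- Lets part 1 apply to every term, placing the whole branch in `Q`. -/
theorem IsBackwardOrbitBranch.mem_alphaLimitSet {y z : unitInterval} {x : ℕ → unitInterval}
    (hx : IsBackwardOrbitBranch f y x) (hz : IsSubseqLimit x z) (N : ℕ) :
    z ∈ alphaLimitSet f (x N) := by
  refine ⟨fun n => x (N + n), fun n => hx.iterate N n, ?_⟩
  rw [isSubseqLimit_iff_frequently] at hz ⊢
  intro U hU
  rw [Filter.frequently_atTop]
  intro M
  obtain ⟨l, hl, hlU⟩ := Filter.frequently_atTop.1 (hz U hU) (N + M)
  exact ⟨l - N, by omega, by rwa [Nat.add_sub_cancel' (by omega)]⟩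

theorem IsGeneratingSequence.mem_specialAlphaLimitSet (hf : Continuous f)
    (hI : IsGeneratingSequence f I) {y s : unitInterval} (hy : y ∈ ⋂ n, orb f (I n))
    (hs : s ∈ ⋂ n, orb f (I n)) (hrec : s ∈ recurrentPoints f) :
    s ∈ specialAlphaLimitSet f y := by
  obtain ⟨x, hx, hxQ⟩ := exists_isBackwardOrbitBranch (fun _ => hI.exists_preimage_mem hf) hy
  refine ⟨x, hx, isSubseqLimit_iff_frequently.2 fun U hU => ?_⟩
  -- Shrinks `U` to a convex neighbourhood of `s`, as the squeezing argument requires.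
  obtain ⟨n, i, hni⟩ := hI.exists_subset hf (U := U.ordConnectedComponent s) inferInstance
    (iterate_mem_iInter_orb hs) (fun i j h => orbitRelated_iterate s h)
    (isSubseqLimit_iff_frequently.1 (show IsSubseqLimit (fun n => f^[n] s) s from hrec) _
      (Set.ordConnectedComponent_mem_nhds.2 hU))
  obtain ⟨-, m, hm, -⟩ := hI
  exact ((hm n).frequently_branch_mem hx (fun j => Set.mem_iInter.1 (hxQ j) n) i).mono
    fun j hj => Set.ordConnectedComponent_subset (hni hj)

theorem IsGeneratingSequence.mem_recurrentPoints (hf : Continuous f)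
    (hI : IsGeneratingSequence f I) {y z : unitInterval} (hz : z ∈ specialAlphaLimitSet f y)
    (hzQ : z ∈ ⋂ n, orb f (I n)) : z ∈ recurrentPoints f := by
  obtain ⟨x, hx, hxz⟩ := hz
  have hxQ : ∀ N, x N ∈ ⋂ n, orb f (I n) := fun N =>
    hI.mem_of_mem_alphaLimitSet hf (hx.mem_alphaLimitSet hxz N) hzQ
  change IsSubseqLimit (fun n => f^[n] z) z
  refine isSubseqLimit_iff_frequently.2 fun U hU => ?_
  obtain ⟨n, i, hni⟩ := hI.exists_subset hf (U := U.ordConnectedComponent z) inferInstance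
    hxQ (fun i j h => hx.orbitRelated h)
    (isSubseqLimit_iff_frequently.1 hxz _ (Set.ordConnectedComponent_mem_nhds.2 hU))
  obtain ⟨-, m, hm, -⟩ := hI
  exact ((hm n).frequently_iterate_mem (Set.mem_iInter.1 hzQ n) i).mono
    fun j hj => Set.ordConnectedComponent_subset (hni hj)

end GeneratingSequence

end IntervalMap

theorem mainTheorem11 (f : unitInterval → unitInterval) (hf : Continuous f)
    (I : ℕ → Set unitInterval) (hI : IntervalMap.IsGeneratingSequence f I)
    (Q S : Set unitInterval) (hQ : Q = ⋂ n, IntervalMap.orb f (I n))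
    (hS : S = Q ∩ IntervalMap.recurrentPoints f) :
    (∀ y : unitInterval, (IntervalMap.alphaLimitSet f y ∩ Q).Nonempty → y ∈ Q) ∧
      ∀ y ∈ Q, S ⊆ IntervalMap.specialAlphaLimitSet f y ∧
        IntervalMap.specialAlphaLimitSet f y ∩ Q = S := by
  subst hQ hS
  refine ⟨fun y ⟨z, hz, hzQ⟩ => hI.mem_of_mem_alphaLimitSet hf hz hzQ, fun y hy => ?_⟩
  have hsub : (⋂ n, IntervalMap.orb f (I n)) ∩ IntervalMap.recurrentPoints f ⊆
      IntervalMap.specialAlphaLimitSet f y :=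
    fun s hs => hI.mem_specialAlphaLimitSet hf hy hs.1 hs.2
  refine ⟨hsub, Set.Subset.antisymm ?_ fun s hs => ⟨hsub hs, hs.1⟩⟩
  exact fun z hz => ⟨hz.2, hI.mem_recurrentPoints hf hz.1 hz.2⟩
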